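/- All digraphs are finite, have at least one vertex, and have no loops or multiple arcs. Write $x\to y$ if there is an arc from $x$ to $y$. For a vertex $x$ of a digraph $D$ let $N^+(x)=\{y : x\to y\}$, $N^-(x)=\{y : y\to x\}$ and $N^{++}(x)=\bigl(\bigcup_{u\in N^+(x)}N^+(u)\bigr)\setminus N^+(x)$ be its out-neighbourhood, in-neighbourhood and second out-neighbourhood, and let $d^+(x)$, $d^-(x)$, $d^{++}(x)$ be the respective cardinalities. A digraph is semicomplete if any two distinct vertices are joined by at least one arc. A local tournament is a digraph with no 2-cycle in which, for every vertex $x$, the subdigraphs induced by $N^+(x)$ and by $N^-(x)$ are both semicomplete (it need not be connected). A vertex $x$ is a Sullivan-1 vertex if $d^{++}(x)\ge d^-(x)$, and a Sullivan-2 vertex if $d^{++}(x)+d^+(x)\ge 2d^-(x)$. Theorem. Let $D$ be a local tournament. Then: (a) $D$ has a Sullivan-1 vertex and a Sullivan-2 vertex. (b) If $D$ has no vertex of in-degree zero, then $D$ has at least two Sullivan-1 vertices. (c) If $D$ has no vertex of in-degree zero, then $D$ has at least two Sullivan-2 vertices, or $D$ has a Sullivan-2 vertex $v$ with $d^{++}(v)+d^+(v)\ge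 2d^-(v)+2$. -/

import Mathlib

namespace Digraph

/-- The digraph has no loops. (Multiple arcs cannot occur in a `Digraph`.) -/
def NoLoops {V : Type*} (D : Digraph V) : Prop :=
  ∀ x, ¬ D.Adj x x

/-- The digraph has no 2-cycle: no two distinct vertices dominate each other. -/
def NoTwoCycle {V : Type*} (D : Digraph V) : Prop :=
  ∀ x y, x ≠ y → ¬ (D.Adj x y ∧ D.Adj y x)

/-- The subdigraph induced by a set of vertices. -/
def inducedOn {V : Type*} (D : Digraph V) (X : Set V) : Digraph X where
  Adj a b := D.Adj a b

/-- Any two distinct vertices are joined by at least one arc. -/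
def IsSemicomplete {V : Type*} (D : Digraph V) : Prop :=
  ∀ x y, x ≠ y → D.Adj x y ∨ D.Adj y x

/-- The out-neighbourhood of `x`. -/
def outNbhd {V : Type*} (D : Digraph V) (x : V) : Set V :=
  {y | D.Adj x y}

/-- The in-neighbourhood of `x`. -/
def inNbhd {V : Type*} (D : Digraph V) (x : V) : Set V :=
  {y | D.Adj y x}

/-- The second out-neighbourhood of `x`. -/
def secondOutNbhd {V : Type*} (D : Digraph V) (x : V) : Set V :=
  (⋃ u ∈ D.outNbhd x, D.outNbhd u) \ D.outNbhd x

/-- The out-degree of `x`; it is used for finite digraphs only, as are the next two. -/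
noncomputable def outDeg {V : Type*} (D : Digraph V) (x : V) : ℕ :=
  (D.outNbhd x).ncard

/-- The in-degree of `x`. -/
noncomputable def inDeg {V : Type*} (D : Digraph V) (x : V) : ℕ :=
  (D.inNbhd x).ncard

/-- The number of vertices in the second out-neighbourhood of `x`. -/
noncomputable def secondOutDeg {V : Type*} (D : Digraph V) (x : V) : ℕ :=
  (D.secondOutNbhd x).ncard

/-- The out-neighbourhood and the in-neighbourhood of each vertex induce semicomplete digraphs. -/
def IsLocallySemicomplete {V : Type*} (D : Digraph V) : Prop :=
  ∀ x, (D.inducedOn (D.outNbhd x)).IsSemicomplete ∧ (D.inducedOn (D.inNbhd x)).IsSemicomplete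

/-- A local tournament: a loopless locally semicomplete digraph with no 2-cycle. -/
structure IsLocalTournament {V : Type*} (D : Digraph V) : Prop where
  noLoops : D.NoLoops
  locallySemicomplete : D.IsLocallySemicomplete
  noTwoCycle : D.NoTwoCycle

/-- `x` is a Sullivan-1 vertex of `D`. -/
def IsSullivan1 {V : Type*} (D : Digraph V) (x : V) : Prop :=
  D.inDeg x ≤ D.secondOutDeg x

/-- `x` is a Sullivan-2 vertex of `D`. -/
def IsSullivan2 {V : Type*} (D : Digraph V) (x : V) : Prop :=
  2 * D.inDeg x ≤ D.secondOutDeg x + D.outDeg x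

end Digraph

/-!
# Sullivan vertices in local tournaments

It suffices to treat a strong local tournament: an initial strong component keeps all in-degrees,
and out-neighbours and second out-neighbours inside it are such in the whole digraph.

The proof works with homogeneous strong tournaments `X` (`IsHomog`): every vertex outside `X`
dominates all of `X`, is dominated by all of `X`, or is adjacent to no vertex of `X`. The central
fact is `IsHomog.trichotomy`. Let `x` be a vertex of maximum out-degree in `X`; it is a king of `X`.
Consider the set `Z` of vertices that `x` does not reach in at most two steps. Either `Z` is empty;
or an initial strong component of a suitable tournament inside `Z` is homogeneous, and all
its in-neighbours lie in `N⁺⁺(x) \ X`; or an initial strong component of `Z` fails to be homogeneous,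
and then each of its kings reaches the whole digraph in two steps. A vertex reaching the whole
digraph in two steps is a Sullivan-1 vertex.

For Sullivan-1 vertices take `X` with the fewest in-neighbours. In the second case of the trichotomy
`|N⁺⁺(x) \ X|` is then at least the number of in-neighbours of `X`, and the in-neighbours of `x`
inside `X` are second out-neighbours, so `x` is a Sullivan-1 vertex. For a second one, a given
vertex is deleted and the argument is applied to an initial strong component of the rest
(`exists_isSullivan1_ne`).

For Sullivan-2 vertices take `X` with the fewest in-neighbours among the homogeneous sets having at
least as many out- as in-neighbours. A homogeneous set violating the latter condition that is not
adjacent to some vertex gives rise to one satisfying it with fewer in-neighbours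
(`IsHomog.exists_balanced`), so the same comparison works (`IsHomog.ncard_inBdry_le`). If the
comparison fails in the third case of the trichotomy, then a king of the tournament found there
satisfies the inequality with slack two (`IsHomog.slack_of_king`). If there were only
one Sullivan-2 vertex and no slack two, `X` would be a single vertex and the unique minimizer, and
this is refuted by the trichotomy or by adding up in-degrees.
-/

namespace Digraph

/-! ### Adjacency in local tournaments -/

section LocalTournament

variable {V : Type*} {D : Digraph V}

theorem IsLocalTournament.asymm (hD : D.IsLocalTournament) {a b : V} (h : D.Adj a b) :
    ¬ D.Adj b a := by
  intro h'
  by_cases hab : a = b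
  · subst hab
    exact hD.noLoops a h
  · exact hD.noTwoCycle a b hab ⟨h, h'⟩

theorem IsLocalTournament.ne (hD : D.IsLocalTournament) {a b : V} (h : D.Adj a b) : a ≠ b := by
  rintro rfl
  exact hD.noLoops a h

/-- Two out-neighbours of a common vertex are adjacent. -/
theorem IsLocalTournament.adj_of_out (hD : D.IsLocalTournament) {u a b : V} (ha : D.Adj u a)
    (hb : D.Adj u b) (hab : a ≠ b) : D.Adj a b ∨ D.Adj b a :=
  (hD.locallySemicomplete u).1 ⟨a, ha⟩ ⟨b, hb⟩ (fun h => hab (congrArg Subtype.val h))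

/-- Two in-neighbours of a common vertex are adjacent. -/
theorem IsLocalTournament.adj_of_in (hD : D.IsLocalTournament) {u a b : V} (ha : D.Adj a u)
    (hb : D.Adj b u) (hab : a ≠ b) : D.Adj a b ∨ D.Adj b a :=
  (hD.locallySemicomplete u).2 ⟨a, ha⟩ ⟨b, hb⟩ (fun h => hab (congrArg Subtype.val h))

end LocalTournament

/-! ### Strong sets and homogeneous tournaments -/

section Strong

variable {V : Type*}

/-- Any two distinct vertices of `X` are adjacent. -/
def SemicompleteOn (D : Digraph V) (X : Set V) : Prop :=
  ∀ x ∈ X, ∀ y ∈ X, x ≠ y → D.Adj x y ∨ D.Adj y x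

/-- The subdigraph induced by `Q` is strongly connected, in the form of a cut condition: every
nonempty proper subset of `Q` is entered by an arc from the rest of `Q`. -/
def StrongOn (D : Digraph V) (Q : Set V) : Prop :=
  ∀ S ⊆ Q, S.Nonempty → S ≠ Q → ∃ s ∈ S, ∃ t ∈ Q, t ∉ S ∧ D.Adj t s

variable {D : Digraph V}

/-- A property that spreads backwards along the arcs of a strong set holds everywhere on it. -/
theorem StrongOn.backward {Q : Set V} (hQ : D.StrongOn Q) {P : V → Prop} {q₀ : V} (h₀ : q₀ ∈ Q)
    (hP : P q₀) (step : ∀ s ∈ Q, ∀ t ∈ Q, D.Adj t s → P s → P t) : ∀ q ∈ Q, P q := by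
  by_contra! hcon
  obtain ⟨q, hq, hPq⟩ := hcon
  obtain ⟨s, hs, t, ht, hts, hadj⟩ := hQ {q ∈ Q | P q} (fun _ h => h.1) ⟨q₀, h₀, hP⟩
    (fun h => hPq (h.symm ▸ hq : q ∈ {q ∈ Q | P q}).2)
  exact hts ⟨ht, step s hs.1 t ht hadj hs.2⟩

/-- A property that spreads forwards along the arcs of a strong set holds everywhere on it. -/
theorem StrongOn.forward {Q : Set V} (hQ : D.StrongOn Q) {P : V → Prop} {q₀ : V} (h₀ : q₀ ∈ Q)
    (hP : P q₀) (step : ∀ s ∈ Q, ∀ t ∈ Q, D.Adj t s → P t → P s) : ∀ q ∈ Q, P q := by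
  by_contra! hcon
  obtain ⟨q, hq, hPq⟩ := hcon
  obtain ⟨s, hs, t, ht, hts, hadj⟩ := hQ {q ∈ Q | ¬ P q} (fun _ h => h.1) ⟨q, hq, hPq⟩
    (fun h => (h.symm ▸ h₀ : q₀ ∈ {q ∈ Q | ¬ P q}).2 hP)
  by_cases hPt : P t
  · exact hs.2 (step s hs.1 t ht hadj hPt)
  · exact hts ⟨ht, hPt⟩

/-- Every nonempty set `T` contains an initial strong component: a strong subset entered by no
arc from the rest of `T`. -/
theorem exists_initial_strong [Finite V] (D : Digraph V) {T : Set V} (hT : T.Nonempty) :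
    ∃ Q ⊆ T, Q.Nonempty ∧ (∀ q ∈ Q, ∀ t ∈ T, D.Adj t q → t ∈ Q) ∧ D.StrongOn Q := by
  obtain ⟨Q, hQ, hmin⟩ := Set.exists_min_image
    {Q : Set V | Q ⊆ T ∧ Q.Nonempty ∧ ∀ q ∈ Q, ∀ t ∈ T, D.Adj t q → t ∈ Q} Set.ncard
    (Set.toFinite _) ⟨T, subset_rfl, hT, fun _ _ t ht _ => ht⟩
  obtain ⟨hQT, hne, hcl⟩ := hQ
  refine ⟨Q, hQT, hne, hcl, fun S hSQ hS hSne => ?_⟩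
  by_contra! hcon
  have hlt : S.ncard < Q.ncard := Set.ncard_lt_ncard (hSQ.ssubset_of_ne hSne)
  refine absurd (hmin S ⟨hSQ.trans hQT, hS, fun s hs t ht hts => ?_⟩) (by omega)
  by_contra htS
  exact hcon s hs t (hcl s (hSQ hs) t ht hts) htS hts

/-- The vertices outside `X` with an arc into `X`. -/
def inBdry (D : Digraph V) (X : Set V) : Set V :=
  {u | u ∉ X ∧ ∃ a ∈ X, D.Adj u a}

/-- The vertices outside `X` with an arc from `X`. -/
def outBdry (D : Digraph V) (X : Set V) : Set V :=
  {w | w ∉ X ∧ ∃ a ∈ X, D.Adj a w}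

/-- A homogeneous strong tournament: a nonempty strong set of pairwise adjacent vertices such that
a vertex outside that dominates one of them dominates them all. In a local tournament the same
then holds for the vertices dominated by the set, see `IsHomog.adj_out`. -/
structure IsHomog (D : Digraph V) (X : Set V) : Prop where
  nonempty : X.Nonempty
  semicomplete : D.SemicompleteOn X
  strong : D.StrongOn X
  adj_in : ∀ u ∉ X, ∀ a ∈ X, D.Adj u a → ∀ b ∈ X, D.Adj u b

theorem isHomog_singleton (D : Digraph V) (v : V) : D.IsHomog {v} where
  nonempty := ⟨v, rfl⟩
  semicomplete := fun x hx y hy hxy => absurd (hx.trans hy.symm) hxy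
  strong := fun S hS hne h => absurd ((Set.subset_singleton_iff_eq.1 hS).resolve_left hne.ne_empty) h
  adj_in := by
    rintro u - a rfl h b rfl
    exact h

theorem IsHomog.adj_out (hD : D.IsLocalTournament) {X : Set V} (hX : D.IsHomog X) {w a b : V}
    (hw : w ∉ X) (ha : a ∈ X) (haw : D.Adj a w) (hb : b ∈ X) : D.Adj b w := by
  refine hX.strong.forward (P := fun b => D.Adj b w) ha haw (fun s hs t ht hts htw => ?_) b hb
  rcases hD.adj_of_out hts htw (fun h => hw (h ▸ hs)) with h | h
  · exact h
  · exact absurd (hX.adj_in w hw s hs h t ht) (hD.asymm htw)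

theorem IsHomog.mem_inBdry_iff {X : Set V} (hX : D.IsHomog X) {x u : V} (hx : x ∈ X) :
    u ∈ D.inBdry X ↔ u ∉ X ∧ D.Adj u x :=
  ⟨fun h => ⟨h.1, let ⟨a, ha, hua⟩ := h.2; hX.adj_in u h.1 a ha hua x hx⟩,
    fun h => ⟨h.1, x, hx, h.2⟩⟩

theorem IsHomog.mem_outBdry_iff (hD : D.IsLocalTournament) {X : Set V} (hX : D.IsHomog X) {x u : V}
    (hx : x ∈ X) : u ∈ D.outBdry X ↔ u ∉ X ∧ D.Adj x u :=
  ⟨fun h => ⟨h.1, let ⟨_, ha, hau⟩ := h.2; hX.adj_out hD h.1 ha hau hx⟩,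
    fun h => ⟨h.1, x, hx, h.2⟩⟩

/-- In a strong local tournament let `O` be a nonempty proper set none of whose vertices dominates
a vertex outside that sends an arc into `O`. Then `O` contains a homogeneous strong tournament that
is entered only by arcs entering `O`: an initial strong component of `O ∩ N⁺(u)`, where `u` is
any vertex outside `O` with an arc into `O`. -/
theorem exists_isHomog_subset [Finite V] (hD : D.IsLocalTournament)
    (hS : D.StrongOn Set.univ) {O : Set V} (hO : O.Nonempty) (hO' : O ≠ Set.univ)
    (h : ∀ u ∉ O, ∀ y ∈ O, D.Adj u y → ∀ z ∈ O, ¬ D.Adj z u) :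
    ∃ Q ⊆ O, D.IsHomog Q ∧ D.inBdry Q ⊆ D.inBdry O := by
  have key : ∀ u ∉ O, ∀ y ∈ O, D.Adj u y → ∀ z ∈ O, D.Adj z y → D.Adj u z :=
    fun u hu y hy huy z hz hzy =>
      (hD.adj_of_in huy hzy (fun e => hu (e ▸ hz))).resolve_right (h u hu y hy huy z hz)
  obtain ⟨y₀, hy₀, c, -, hc, hcy⟩ := hS O (Set.subset_univ _) hO hO'
  obtain ⟨Q, hQT, hne, hcl, hst⟩ :=
    D.exists_initial_strong (T := {t ∈ O | D.Adj c t}) ⟨y₀, hy₀, hcy⟩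
  have hQO : Q ⊆ O := fun q hq => (hQT hq).1
  have hout : ∀ u ∉ Q, ∀ q ∈ Q, D.Adj u q → u ∉ O := fun u hu q hq huq huO =>
    hu (hcl q hq u ⟨huO, key c hc q (hQO hq) (hQT hq).2 u huO huq⟩ huq)
  refine ⟨Q, hQO, ⟨hne, fun x hx y hy hxy => hD.adj_of_out (hQT hx).2 (hQT hy).2 hxy, hst,
    fun u hu a ha hua => ?_⟩, fun u hu => ?_⟩
  · exact hst.backward (P := fun b => D.Adj u b) ha hua fun s hs t ht hts hus =>
      key u (hout u hu a ha hua) s (hQO hs) hus t (hQO ht) hts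
  · obtain ⟨hu, q, hq, huq⟩ := hu
    exact ⟨hout u hu q hq huq, q, hQO hq, huq⟩

/-- If some vertex is adjacent to no vertex of the homogeneous set `X`, then there is a
homogeneous set that is not adjacent to `X` and is entered only from the out-neighbours of `X`. -/
theorem IsHomog.exists_nonadj [Finite V] (hD : D.IsLocalTournament)
    (hS : D.StrongOn Set.univ) {X : Set V} (hX : D.IsHomog X) {x o : V} (hx : x ∈ X) (ho : o ∉ X)
    (hxo : ¬ D.Adj x o) (hox : ¬ D.Adj o x) :
    ∃ Q, D.IsHomog Q ∧ (∀ q ∈ Q, q ∉ X ∧ ¬ D.Adj x q ∧ ¬ D.Adj q x) ∧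
      D.inBdry Q ⊆ D.outBdry X := by
  have key : ∀ u ∉ {o | o ∉ X ∧ ¬ D.Adj x o ∧ ¬ D.Adj o x},
      ∀ y ∈ {o | o ∉ X ∧ ¬ D.Adj x o ∧ ¬ D.Adj o x}, D.Adj u y → u ∉ X ∧ D.Adj x u := by
    rintro u hu y ⟨hy, hxy, hyx⟩ huy
    have huX : u ∉ X := fun h => hxy (hX.adj_out hD hy h huy hx)
    refine ⟨huX, ?_⟩
    by_contra hxu
    have hux : D.Adj u x := by
      by_contra hux
      exact hu ⟨huX, hxu, hux⟩
    rcases hD.adj_of_out hux huy (fun e => hy (e ▸ hx)) with h | h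
    · exact hxy h
    · exact hyx h
  obtain ⟨Q, hQO, hQ, hb⟩ := exists_isHomog_subset hD hS
    (O := {o | o ∉ X ∧ ¬ D.Adj x o ∧ ¬ D.Adj o x}) ⟨o, ho, hxo, hox⟩
    (fun h => (h.symm ▸ Set.mem_univ x : x ∈ {o | o ∉ X ∧ ¬ D.Adj x o ∧ ¬ D.Adj o x}).1 hx)
    (by
      rintro u hu y hy huy z ⟨hz, hxz, hzx⟩ hzu
      rcases hD.adj_of_in hzu (key u hu y hy huy).2 (fun e => hz (e ▸ hx)) with h | h
      · exact hzx h
      · exact hxz h)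
  refine ⟨Q, hQ, hQO, fun u hu => ?_⟩
  obtain ⟨hu, y, hy, huy⟩ := hb hu
  exact (hX.mem_outBdry_iff hD hx).2 (key u hu y hy huy)

end Strong
/-! ### Kings -/

section Kings

variable {V : Type*}

/-- `y` is reached from `x` by a directed path of length one or two. -/
def Reach (D : Digraph V) (x y : V) : Prop :=
  D.Adj x y ∨ ∃ z, D.Adj x z ∧ D.Adj z y

/-- `x` reaches every other vertex by a directed path of length at most two. -/
def IsKing (D : Digraph V) (x : V) : Prop :=
  ∀ y, y ≠ x → D.Reach x y

/-- `x` is a king of the subdigraph induced by `X`. -/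
def IsKingOn (D : Digraph V) (X : Set V) (x : V) : Prop :=
  x ∈ X ∧ ∀ y ∈ X, y ≠ x → D.Adj x y ∨ ∃ z ∈ X, D.Adj x z ∧ D.Adj z y

/-- `x` has maximum out-degree in the subdigraph induced by `X`. -/
def IsTopOn (D : Digraph V) (X : Set V) (x : V) : Prop :=
  x ∈ X ∧ ∀ y ∈ X, (D.outNbhd y ∩ X).ncard ≤ (D.outNbhd x ∩ X).ncard

variable {D : Digraph V}

theorem mem_secondOutNbhd {x y : V} :
    y ∈ D.secondOutNbhd x ↔ (∃ u, D.Adj x u ∧ D.Adj u y) ∧ ¬ D.Adj x y := by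
  simp [secondOutNbhd, outNbhd]

theorem IsKingOn.reach {X : Set V} {x y : V} (h : D.IsKingOn X x) (hy : y ∈ X) (hne : y ≠ x) :
    D.Reach x y :=
  (h.2 y hy hne).imp_right fun ⟨z, _, hz⟩ => ⟨z, hz⟩

theorem exists_isTopOn [Finite V] (D : Digraph V) {X : Set V} (hX : X.Nonempty) :
    ∃ x, D.IsTopOn X x := by
  obtain ⟨x, hx, h⟩ := Set.exists_max_image X (fun x => (D.outNbhd x ∩ X).ncard) X.toFinite hX
  exact ⟨x, hx, h⟩

theorem IsTopOn.isKingOn [Finite V] (hD : D.IsLocalTournament) {X : Set V}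
    (hX : D.SemicompleteOn X) {x : V} (hx : D.IsTopOn X x) : D.IsKingOn X x := by
  refine ⟨hx.1, fun y hy hyx => ?_⟩
  by_contra! hcon
  obtain ⟨hxy, hz⟩ := hcon
  have hyx' : D.Adj y x := (hX x hx.1 y hy hyx.symm).resolve_left hxy
  have hlt : (D.outNbhd x ∩ X).ncard < (D.outNbhd y ∩ X).ncard := by
    refine Set.ncard_lt_ncard ⟨fun z hzx => ⟨?_, hzx.2⟩, fun h => ?_⟩
    · exact (hX y hy z hzx.2 (fun e => hxy (e ▸ hzx.1))).resolve_right (hz z hzx.2 hzx.1)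
    · exact hD.noLoops x (h ⟨hyx', hx.1⟩).1
  exact absurd (hx.2 y hy) (by omega)

theorem exists_isKingOn [Finite V] (hD : D.IsLocalTournament) {X : Set V} (hX : X.Nonempty)
    (hX' : D.SemicompleteOn X) : ∃ x, D.IsKingOn X x :=
  (D.exists_isTopOn hX).imp fun _ h => h.isKingOn hD hX'

/-- Suppose that every vertex that `x` does not reach dominates `x`, and let `Q` be an initial
strong component of the tournament on those vertices. If a vertex `c` outside `Q` dominates some
vertices of `Q` but not all of them, then every king of `Q` is a king of the whole digraph.

The reason is that an out-neighbour `b` of `x` that is adjacent to a vertex of `Q` is dominated by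
all of `Q`. The in-neighbours of `c` in `N⁺(x)` are of this kind, and the existence of `c` forces
every vertex outside `Q` that is not dominated by `x` to have an in-neighbour of this kind. -/
theorem isKing_of_not_adj_in (hD : D.IsLocalTournament) (hS : D.StrongOn Set.univ) {x : V}
    (hZ : ∀ z, z ≠ x → ¬ D.Reach x z → D.Adj z x) {Q : Set V}
    (hQZ : ∀ q ∈ Q, q ≠ x ∧ ¬ D.Reach x q)
    (hcl : ∀ q ∈ Q, ∀ z, z ≠ x → ¬ D.Reach x z → D.Adj z q → z ∈ Q)
    (hst : D.StrongOn Q) {c q₁ q₂ : V} (hcQ : c ∉ Q) (hq₁ : q₁ ∈ Q) (hq₂ : q₂ ∈ Q)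
    (hc₁ : D.Adj c q₁) (hc₂ : ¬ D.Adj c q₂) {y : V} (hy : D.IsKingOn Q y) : D.IsKing y := by
  have hQx : ∀ q ∈ Q, D.Adj q x := fun q hq => hZ q (hQZ q hq).1 (hQZ q hq).2
  have hbQ : ∀ b, D.Adj x b → ∀ q ∈ Q, ¬ D.Adj b q := fun b hb q hq hbq =>
    (hQZ q hq).2 (.inr ⟨b, hb, hbq⟩)
  -- no in-neighbour of `x` dominates a vertex not adjacent to `x`
  have hAN : ∀ a n, D.Adj a x → n ≠ x → ¬ D.Adj x n → ¬ D.Adj n x → ¬ D.Adj a n := by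
    intro a n ha hn hxn hnx han
    rcases hD.adj_of_out ha han hn.symm with h | h
    · exact hxn h
    · exact hnx h
  -- there is an arc `t → s` of `Q` with `t → c → s`
  obtain ⟨s, ⟨hsQ, hcs⟩, t, htQ, htS, hts⟩ := hst {q ∈ Q | D.Adj c q} (fun _ h => h.1)
    ⟨q₁, hq₁, hc₁⟩ (fun h => hc₂ (h.symm ▸ hq₂ : q₂ ∈ {q ∈ Q | D.Adj c q}).2)
  have htc : D.Adj t c := by
    rcases hD.adj_of_in hcs hts (fun e => hcQ (e ▸ htQ)) with h | h
    · exact absurd ⟨htQ, h⟩ htS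
    · exact h
  have hcx : c ≠ x := by
    rintro rfl
    exact (hQZ s hsQ).2 (.inl hcs)
  have hxc : ¬ D.Adj x c := fun h => hbQ c h s hsQ hcs
  have hcA : D.Adj c x := by
    by_contra h
    exact hAN t c (hQx t htQ) hcx hxc h htc
  obtain ⟨b₀, hb₀, hb₀c⟩ : ∃ b, D.Adj x b ∧ D.Adj b c := by
    by_contra! h
    refine hcQ (hcl s hsQ c hcx ?_ hcs)
    rintro (h' | ⟨b, hb, hbc⟩)
    · exact hxc h'
    · exact h b hb hbc
  -- an out-neighbour of `x` adjacent to a vertex of `Q` is dominated by all of `Q`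
  have hstar : ∀ b, D.Adj x b → ∀ q ∈ Q, (D.Adj q b ∨ D.Adj b q) → ∀ q' ∈ Q, D.Adj q' b := by
    intro b hb q hq hqb
    refine hst.forward hq (hqb.resolve_right (hbQ b hb q hq)) fun s' hs' t' ht' h h' => ?_
    refine (hD.adj_of_out h h' ?_).resolve_right (hbQ b hb s' hs')
    rintro rfl
    exact (hQZ _ hs').2 (.inl hb)
  have hneB : ∀ b, D.Adj x b → ∀ q ∈ Q, q ≠ b := by
    rintro b hb q hq rfl
    exact (hQZ _ hq).2 (.inl hb)
  have hG1 : ∀ b, D.Adj x b → D.Adj b c → ∀ q ∈ Q, D.Adj q b := fun b hb hbc =>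
    hstar b hb t htQ (hD.adj_of_in htc hbc (hneB b hb t htQ))
  have hG2 : ∀ a, D.Adj a x → D.Reach x a → ∃ b, D.Adj x b ∧ (∀ q ∈ Q, D.Adj q b) ∧ D.Adj b a := by
    intro a ha hra
    obtain ⟨b, hb, hba⟩ : ∃ b, D.Adj x b ∧ D.Adj b a := hra.resolve_left (hD.asymm ha)
    by_contra! hno
    have hnb : ∀ q ∈ Q, ¬ (D.Adj q b ∨ D.Adj b q) := fun q hq h =>
      hno b hb (hstar b hb q hq h) hba
    by_cases hac : a = c
    · subst hac
      exact hno b hb (hG1 b hb hba) hba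
    rcases hD.adj_of_in ha hcA hac with h | h
    · have hab₀ : a ≠ b₀ := by
        rintro rfl
        exact hD.asymm ha hb₀
      rcases hD.adj_of_in h hb₀c hab₀ with h1 | h1
      · have hbb₀ : b ≠ b₀ := by
          rintro rfl
          exact hD.asymm h1 hba
        rcases hD.adj_of_out hb hb₀ hbb₀ with h2 | h2
        · exact hnb s hsQ (hD.adj_of_in (hG1 b₀ hb₀ hb₀c s hsQ) h2 (hneB b hb s hsQ))
        · have hcb : c ≠ b := by
            rintro rfl
            exact hxc hb
          rcases hD.adj_of_out hb₀c h2 hcb with h3 | h3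
          · exact hnb s hsQ (hD.adj_of_out hcs h3 (hneB b hb s hsQ))
          · exact hnb s hsQ (.inl (hG1 b hb h3 s hsQ))
      · exact hno b₀ hb₀ (hG1 b₀ hb₀ hb₀c) h1
    · have hcb : c ≠ b := by
        rintro rfl
        exact hxc hb
      rcases hD.adj_of_in h hba hcb with h3 | h3
      · exact hnb s hsQ (hD.adj_of_out hcs h3 (hneB b hb s hsQ))
      · exact hnb s hsQ (.inl (hG1 b hb h3 s hsQ))
  -- the vertices not adjacent to `x` are treated by going along a path that leaves their set
  have hG3 : ∀ n, n ≠ x → ¬ D.Adj x n → ¬ D.Adj n x →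
      ∃ b, D.Adj x b ∧ (∀ q ∈ Q, D.Adj q b) ∧ D.Adj b n := by
    intro n hn hxn hnx
    by_contra hno
    obtain ⟨w, hw, m, -, hm, hmw⟩ := hS {m | ¬ (m ≠ x ∧ ¬ D.Adj x m ∧ ¬ D.Adj m x ∧
      ¬ ∃ b, D.Adj x b ∧ (∀ q ∈ Q, D.Adj q b) ∧ D.Adj b m)} (Set.subset_univ _)
      ⟨x, fun h => h.1 rfl⟩ (fun h => (Set.ext_iff.1 h n).2 (Set.mem_univ n) ⟨hn, hxn, hnx, hno⟩)
    obtain ⟨hmx, hxm, hmx', hmno⟩ := not_not.1 hm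
    have hBm : ∀ b, D.Adj x b → (∀ q ∈ Q, D.Adj q b) → ∀ w, D.Adj b w → D.Adj m w → False := by
      intro b hb hbq w hbw hmw
      rcases hD.adj_of_in hbw hmw (fun e => hxm (e ▸ hb)) with h | h
      · exact hmno ⟨b, hb, hbq, h⟩
      · rcases hD.adj_of_in h hb hmx with h' | h'
        · exact hmx' h'
        · exact hxm h'
    have hmA : ∀ a, D.Adj a x → D.Reach x a → ¬ D.Adj m a := by
      intro a ha hra hma
      obtain ⟨b, hb, hbq, hba⟩ := hG2 a ha hra
      exact hBm b hb hbq a hba hma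
    have hmQ : ∀ q ∈ Q, ¬ D.Adj m q := by
      intro q hq hmq
      have hms : D.Adj m s := by
        refine hst.backward (P := fun q => D.Adj m q) hq hmq (fun s' hs' t' ht' h h' => ?_) s hsQ
        refine (hD.adj_of_in h h' ?_).resolve_left (hAN t' m (hQx t' ht') hmx hxm hmx')
        rintro rfl
        exact hmx' (hQx _ ht')
      have hcm : c ≠ m := by
        rintro rfl
        exact hmx' hcA
      exact hmA c hcA (.inr ⟨b₀, hb₀, hb₀c⟩)
        ((hD.adj_of_in hcs hms hcm).resolve_left (hAN c m hcA hmx hxm hmx'))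
    by_cases hwx : w = x
    · subst hwx
      exact hmx' hmw
    by_cases hxw : D.Adj x w
    · rcases hD.adj_of_in hmw hxw hmx with h | h
      · exact hmx' h
      · exact hxm h
    by_cases hwA : D.Adj w x
    · by_cases hwr : D.Reach x w
      · exact hmA w hwA hwr hmw
      · by_cases hwQ : w ∈ Q
        · exact hmQ w hwQ hmw
        · have hsw : D.Adj s w := by
            refine (hD.adj_of_in (hQx s hsQ) hwA (fun e => hwQ (e ▸ hsQ))).resolve_right ?_
            exact fun h => hwQ (hcl s hsQ w hwx hwr h)
          refine hmQ s hsQ ((hD.adj_of_in hsw hmw ?_).resolve_left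
            (hAN s m (hQx s hsQ) hmx hxm hmx'))
          rintro rfl
          exact hmx' (hQx _ hsQ)
    · by_cases hb : ∃ b, D.Adj x b ∧ (∀ q ∈ Q, D.Adj q b) ∧ D.Adj b w
      · obtain ⟨b, hb, hbq, hbw⟩ := hb
        exact hBm b hb hbq w hbw hmw
      · exact hw ⟨hwx, hxw, hwA, hb⟩
  intro w hwy
  have hyx := hQx y hy.1
  by_cases hwx : w = x
  · exact .inl (hwx ▸ hyx)
  by_cases hxw : D.Adj x w
  · exact .inr ⟨x, hyx, hxw⟩
  by_cases hwA : D.Adj w x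
  · by_cases hwr : D.Reach x w
    · obtain ⟨b, -, hbq, hbw⟩ := hG2 w hwA hwr
      exact .inr ⟨b, hbq y hy.1, hbw⟩
    · by_cases hwQ : w ∈ Q
      · exact hy.reach hwQ hwy
      · refine .inl ((hD.adj_of_in hyx hwA hwy.symm).resolve_right ?_)
        exact fun h => hwQ (hcl y hy.1 w hwx hwr h)
  · obtain ⟨b, -, hbq, hbw⟩ := hG3 w hwx hxw hwA
    exact .inr ⟨b, hbq y hy.1, hbw⟩

/-- The structure lemma behind all three parts. Let `x` be a king of a homogeneous set `X` in a
strong local tournament. Then `x` is a king, or among the vertices not reached from `x` there is a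
homogeneous set `Q` entered only from `N⁺⁺(x) \ X`, or there is a tournament `Q` among them, likewise
entered only from `N⁺⁺(x) \ X`, all of whose kings are kings of the whole digraph. -/
theorem IsHomog.trichotomy [Finite V] (hD : D.IsLocalTournament) (hS : D.StrongOn Set.univ)
    {X : Set V} (hX : D.IsHomog X) {x : V} (hx : D.IsKingOn X x) :
    D.IsKing x ∨
    (∃ Q, D.IsHomog Q ∧ (∀ q ∈ Q, q ≠ x ∧ ¬ D.Reach x q) ∧
      D.inBdry Q ⊆ D.secondOutNbhd x \ X ∧
      ((∀ q ∈ Q, ¬ D.Adj q x) ∨ ∀ q ∈ Q, D.Adj q x)) ∨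
    (∃ Q : Set V, Q.Nonempty ∧ D.SemicompleteOn Q ∧ (∀ q ∈ Q, q ∉ X ∧ D.Adj q x ∧ ¬ D.Reach x q) ∧
      (∀ q ∈ Q, ∀ u, D.Adj u q → u ∈ Q ∨ u ∈ D.secondOutNbhd x \ X) ∧
      ∀ y, D.IsKingOn Q y → D.IsKing y) := by
  have hZX : ∀ z, z ≠ x → ¬ D.Reach x z → z ∉ X := fun z hz hr hzX => hr (hx.reach hzX hz)
  by_cases hZ : ∀ z, z ≠ x → ¬ D.Reach x z → D.Adj z x
  swap
  · push Not at hZ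
    obtain ⟨z₀, hz₀, hr₀, ha₀⟩ := hZ
    have key : ∀ u ∉ {z | z ≠ x ∧ ¬ D.Reach x z ∧ ¬ D.Adj z x},
        ∀ y ∈ {z | z ≠ x ∧ ¬ D.Reach x z ∧ ¬ D.Adj z x}, D.Adj u y →
        u ∉ X ∧ (∃ b, D.Adj x b ∧ D.Adj b u) ∧ ¬ D.Adj x u := by
      rintro u hu y ⟨hyx, hyr, hya⟩ huy
      have hux : u ≠ x := by
        rintro rfl
        exact hyr (.inl huy)
      have hxu : ¬ D.Adj x u := fun h => hyr (.inr ⟨u, h, huy⟩)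
      have hux' : ¬ D.Adj u x := by
        intro h
        rcases hD.adj_of_out h huy hyx.symm with h' | h'
        · exact hyr (.inl h')
        · exact hya h'
      refine ⟨fun h => hyr (.inl (hX.adj_out hD (hZX y hyx hyr) h huy hx.1)), ?_, hxu⟩
      by_contra hb
      exact hu ⟨hux, fun h => h.elim hxu hb, hux'⟩
    obtain ⟨Q, hQO, hQ, hb⟩ := exists_isHomog_subset hD hS
      (O := {z | z ≠ x ∧ ¬ D.Reach x z ∧ ¬ D.Adj z x}) ⟨z₀, hz₀, hr₀, ha₀⟩
      (fun h => (h.symm ▸ Set.mem_univ x : x ∈ {z | z ≠ x ∧ ¬ D.Reach x z ∧ ¬ D.Adj z x}).1 rfl)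
      (by
        rintro u hu y hy huy z ⟨hzx, hzr, hza⟩ hzu
        obtain ⟨-, ⟨b, hb, hbu⟩, -⟩ := key u hu y hy huy
        have hzb : z ≠ b := by
          rintro rfl
          exact hzr (.inl hb)
        have hzb' : D.Adj z b := (hD.adj_of_in hzu hbu hzb).resolve_right
          fun h => hzr (.inr ⟨b, hb, h⟩)
        rcases hD.adj_of_in hzb' hb hzx with h | h
        · exact hza h
        · exact hzr (.inl h))
    refine .inr (.inl ⟨Q, hQ, fun q hq => ⟨(hQO hq).1, (hQO hq).2.1⟩, fun u hu => ?_,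
      .inl fun q hq => (hQO hq).2.2⟩)
    obtain ⟨hu, y, hy, huy⟩ := hb hu
    obtain ⟨h1, h2, h3⟩ := key u hu y hy huy
    exact ⟨mem_secondOutNbhd.2 ⟨h2, h3⟩, h1⟩
  by_cases hking : D.IsKing x
  · exact .inl hking
  obtain ⟨z₀, hz₀⟩ : ∃ z, z ≠ x ∧ ¬ D.Reach x z := by
    simpa [IsKing] using hking
  obtain ⟨Q, hQZ, hne, hcl, hst⟩ :=
    D.exists_initial_strong (T := {z | z ≠ x ∧ ¬ D.Reach x z}) ⟨z₀, hz₀⟩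
  have hQx : ∀ q ∈ Q, D.Adj q x := fun q hq => hZ q (hQZ hq).1 (hQZ hq).2
  have hsemi : D.SemicompleteOn Q := fun a ha b hb hab => hD.adj_of_in (hQx a ha) (hQx b hb) hab
  have hin : ∀ q ∈ Q, ∀ u, D.Adj u q → u ∈ Q ∨ u ∈ D.secondOutNbhd x \ X := by
    intro q hq u huq
    by_cases huQ : u ∈ Q
    · exact .inl huQ
    right
    have hux : u ≠ x := by
      rintro rfl
      exact (hQZ hq).2 (.inl huq)
    have hxu : ¬ D.Adj x u := fun h => (hQZ hq).2 (.inr ⟨u, h, huq⟩)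
    have hr : D.Reach x u := by
      by_contra hr
      exact huQ (hcl q hq u ⟨hux, hr⟩ huq)
    refine ⟨mem_secondOutNbhd.2 ⟨hr.resolve_left hxu, hxu⟩, fun huX => ?_⟩
    exact hD.asymm huq (hX.adj_in q (hZX q (hQZ hq).1 (hQZ hq).2) x hx.1 (hQx q hq) u huX)
  by_cases hmod : ∀ u ∉ Q, ∀ a ∈ Q, D.Adj u a → ∀ b ∈ Q, D.Adj u b
  · refine .inr (.inl ⟨Q, ⟨hne, hsemi, hst, hmod⟩, fun q hq => hQZ hq, ?_, .inr hQx⟩)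
    rintro u ⟨huQ, q, hq, huq⟩
    exact (hin q hq u huq).resolve_left huQ
  · push Not at hmod
    obtain ⟨c, hcQ, q₁, hq₁, hc₁, q₂, hq₂, hc₂⟩ := hmod
    exact .inr (.inr ⟨Q, hne, hsemi,
      fun q hq => ⟨hZX q (hQZ hq).1 (hQZ hq).2, hQx q hq, (hQZ hq).2⟩, hin,
      fun y hy => isKing_of_not_adj_in hD hS hZ (fun q hq => hQZ hq)
        (fun q hq z hz hr => hcl q hq z ⟨hz, hr⟩) hst hcQ hq₁ hq₂ hc₁ hc₂ hy⟩)

end Kings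
/-! ### Degrees -/

section Degrees

variable {V : Type*} {D : Digraph V}

theorem IsKing.inNbhd_subset (hD : D.IsLocalTournament) {x : V} (hx : D.IsKing x) :
    D.inNbhd x ⊆ D.secondOutNbhd x := fun u hu =>
  mem_secondOutNbhd.2 ⟨(hx u (hD.ne hu)).resolve_left (hD.asymm hu), hD.asymm hu⟩

theorem IsHomog.inBdry_subset (hD : D.IsLocalTournament) {X : Set V} (hX : D.IsHomog X) {x : V}
    (hx : x ∈ X) (hk : D.IsKing x) : D.inBdry X ⊆ D.secondOutNbhd x \ X := fun _ hu =>
  have hu' := (hX.mem_inBdry_iff hx).1 hu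
  ⟨hk.inNbhd_subset hD hu'.2, hu'.1⟩

theorem inBdry_singleton (hD : D.IsLocalTournament) (v : V) : D.inBdry {v} = D.inNbhd v := by
  ext u
  rw [(D.isHomog_singleton v).mem_inBdry_iff rfl]
  exact ⟨fun h => h.2, fun h => ⟨hD.ne h, h⟩⟩

theorem outBdry_singleton (hD : D.IsLocalTournament) (v : V) : D.outBdry {v} = D.outNbhd v := by
  ext u
  rw [(D.isHomog_singleton v).mem_outBdry_iff hD rfl]
  exact ⟨fun h => h.2, fun h => ⟨(hD.ne h).symm, h⟩⟩

variable [Finite V]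

theorem isSullivan1_of_subset {x : V} (h : D.inNbhd x ⊆ D.secondOutNbhd x) : D.IsSullivan1 x :=
  Set.ncard_le_ncard h

theorem IsHomog.inDeg_eq {X : Set V} (hX : D.IsHomog X) {x : V} (hx : x ∈ X) :
    D.inDeg x = (D.inBdry X).ncard + (D.inNbhd x ∩ X).ncard := by
  have : D.inBdry X = D.inNbhd x \ X := by
    ext u
    rw [hX.mem_inBdry_iff hx]
    exact and_comm
  rw [this, inDeg, add_comm, Set.ncard_inter_add_ncard_sdiff_eq_ncard]

theorem IsHomog.outDeg_eq (hD : D.IsLocalTournament) {X : Set V} (hX : D.IsHomog X) {x : V}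
    (hx : x ∈ X) : D.outDeg x = (D.outBdry X).ncard + (D.outNbhd x ∩ X).ncard := by
  have : D.outBdry X = D.outNbhd x \ X := by
    ext u
    rw [hX.mem_outBdry_iff hD hx]
    exact and_comm
  rw [this, outDeg, add_comm, Set.ncard_inter_add_ncard_sdiff_eq_ncard]

theorem IsHomog.secondOutDeg_eq (hD : D.IsLocalTournament) {X : Set V} (hX : D.IsHomog X) {x : V}
    (hx : D.IsKingOn X x) :
    D.secondOutDeg x = (D.secondOutNbhd x \ X).ncard + (D.inNbhd x ∩ X).ncard := by
  have : D.inNbhd x ∩ X = D.secondOutNbhd x ∩ X := by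
    ext u
    constructor
    · rintro ⟨hu, huX⟩
      exact ⟨mem_secondOutNbhd.2 ⟨(hx.reach huX (hD.ne hu)).resolve_left (hD.asymm hu),
        hD.asymm hu⟩, huX⟩
    · rintro ⟨hu, huX⟩
      obtain ⟨⟨b, hxb, hbu⟩, hxu⟩ := mem_secondOutNbhd.1 hu
      have hne : x ≠ u := by
        rintro rfl
        exact hD.asymm hxb hbu
      exact ⟨(hX.semicomplete x hx.1 u huX hne).resolve_left hxu, huX⟩
  rw [this, secondOutDeg, add_comm, Set.ncard_inter_add_ncard_sdiff_eq_ncard]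

end Degrees

/-! ### Induced subdigraphs -/

section Induced

variable {V : Type*} {D : Digraph V}

theorem IsLocalTournament.inducedOn (hD : D.IsLocalTournament) (U : Set V) :
    (D.inducedOn U).IsLocalTournament where
  noLoops := fun x => hD.noLoops x
  locallySemicomplete := fun _ =>
    ⟨fun a b hab => hD.adj_of_out a.2 b.2 fun e => hab (Subtype.ext (Subtype.ext e)),
      fun a b hab => hD.adj_of_in a.2 b.2 fun e => hab (Subtype.ext (Subtype.ext e))⟩
  noTwoCycle := fun x y hxy => hD.noTwoCycle x y fun e => hxy (Subtype.ext e)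

theorem StrongOn.inducedOn {U : Set V} (hU : D.StrongOn U) :
    (D.inducedOn U).StrongOn Set.univ := by
  intro S _ hS hne
  obtain ⟨s, ⟨s, hs, rfl⟩, t, ht, htS, hts⟩ := hU (Subtype.val '' S) (by simp)
    (hS.image _) (fun h => hne (Set.eq_univ_of_forall fun u => by
      obtain ⟨v, hv, hvu⟩ := (Set.ext_iff.1 h u).2 u.2
      exact Subtype.ext hvu ▸ hv))
  exact ⟨s, hs, ⟨t, ht⟩, trivial, fun h => htS ⟨_, h, rfl⟩, hts⟩

theorem image_inNbhd_inducedOn (D : Digraph V) {U : Set V} (v : U) :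
    Subtype.val '' (D.inducedOn U).inNbhd v = D.inNbhd v ∩ U := by
  ext u
  constructor
  · rintro ⟨u, hu, rfl⟩
    exact ⟨hu, u.2⟩
  · rintro ⟨hu, huU⟩
    exact ⟨⟨u, huU⟩, hu, rfl⟩

theorem image_outNbhd_inducedOn (D : Digraph V) {U : Set V} (v : U) :
    Subtype.val '' (D.inducedOn U).outNbhd v = D.outNbhd v ∩ U := by
  ext u
  constructor
  · rintro ⟨u, hu, rfl⟩
    exact ⟨hu, u.2⟩
  · rintro ⟨hu, huU⟩
    exact ⟨⟨u, huU⟩, hu, rfl⟩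

theorem image_secondOutNbhd_inducedOn_subset (D : Digraph V) {U : Set V} (v : U) :
    Subtype.val '' (D.inducedOn U).secondOutNbhd v ⊆ D.secondOutNbhd v := by
  rintro _ ⟨u, hu, rfl⟩
  obtain ⟨⟨b, hb, hbu⟩, hvu⟩ := mem_secondOutNbhd.1 hu
  exact mem_secondOutNbhd.2 ⟨⟨b, hb, hbu⟩, hvu⟩

theorem inDeg_inducedOn (D : Digraph V) {U : Set V} (v : U) :
    (D.inducedOn U).inDeg v = (D.inNbhd v ∩ U).ncard := by
  rw [← image_inNbhd_inducedOn, Set.ncard_image_of_injective _ Subtype.val_injective, inDeg]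

theorem outDeg_inducedOn_le [Finite V] (D : Digraph V) {U : Set V} (v : U) :
    (D.inducedOn U).outDeg v ≤ D.outDeg v := by
  rw [outDeg, ← Set.ncard_image_of_injective _ Subtype.val_injective, image_outNbhd_inducedOn]
  exact Set.ncard_le_ncard Set.inter_subset_left

theorem secondOutDeg_inducedOn_le [Finite V] (D : Digraph V) {U : Set V} (v : U) :
    (D.inducedOn U).secondOutDeg v ≤ D.secondOutDeg v := by
  rw [secondOutDeg, ← Set.ncard_image_of_injective _ Subtype.val_injective]
  exact Set.ncard_le_ncard (image_secondOutNbhd_inducedOn_subset D v)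

/-- A vertex set entered by no arc from outside keeps its in-degrees. -/
theorem inDeg_inducedOn_eq {U : Set V} (hU : ∀ u ∈ U, ∀ t, D.Adj t u → t ∈ U) (v : U) :
    (D.inducedOn U).inDeg v = D.inDeg v := by
  rw [inDeg_inducedOn, inDeg, Set.inter_eq_left.2 (show D.inNbhd v ⊆ U from hU v v.2)]

end Induced

/-! ### Sullivan-1 vertices -/

section Sullivan1

/-- In a strong local tournament choose the homogeneous sets `X` with the fewest in-neighbours.
By the trichotomy a vertex of maximum out-degree in such an `X` is a Sullivan-1 vertex, unless some
king exists anyway. If these vertices all lie in the tournament `S` and have no slack, then a king of the tournament formed by them is a king of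
the whole digraph, since the alternative in the trichotomy yields another vertex of this kind that
it does not reach. -/
theorem exists_inDeg_le_secondOutDeg {V : Type*} [Finite V] [Nonempty V] {D : Digraph V}
    (hD : D.IsLocalTournament) (hS : D.StrongOn Set.univ) {S : Set V} (hSc : D.SemicompleteOn S) :
    (∃ v, v ∉ S ∧ D.inDeg v ≤ D.secondOutDeg v) ∨ (∃ v, D.inDeg v < D.secondOutDeg v) ∨
      ∃ v ∈ S, D.IsKing v := by
  by_contra! hcon
  obtain ⟨h1, h2, h3⟩ := hcon
  have hnoking : ∀ v, ¬ D.IsKing v := by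
    intro v hv
    by_cases hvS : v ∈ S
    · exact h3 v hvS hv
    · exact absurd (isSullivan1_of_subset (hv.inNbhd_subset hD)) (not_le.2 (h1 v hvS))
  obtain ⟨X₀, hX₀, hmin₀⟩ := Set.exists_min_image {X | D.IsHomog X}
    (fun X => (D.inBdry X).ncard) (Set.toFinite _) ⟨_, D.isHomog_singleton (Classical.arbitrary V)⟩
  have hstep : ∀ X, D.IsHomog X → (D.inBdry X).ncard = (D.inBdry X₀).ncard →
      ∀ x, D.IsTopOn X x → x ∈ S ∧ ∃ Q y, D.IsHomog Q ∧
        (D.inBdry Q).ncard = (D.inBdry X₀).ncard ∧ D.IsTopOn Q y ∧ y ≠ x ∧ ¬ D.Reach x y := by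
    intro X hX hXmin x hx
    have hxk := hx.isKingOn hD hX.semicomplete
    have hin := hX.inDeg_eq hx.1
    have hsec := hX.secondOutDeg_eq hD hxk
    rcases hX.trichotomy hD hS hxk with h | ⟨Q, hQ, hQZ, hQb, -⟩ | ⟨Q, hQne, hQs, -, -, hQk⟩
    · exact absurd h (hnoking x)
    · have hle := Set.ncard_le_ncard hQb
      have hmin := hmin₀ Q hQ
      obtain ⟨y, hy⟩ := D.exists_isTopOn hQ.nonempty
      have hxs := h2 x
      refine ⟨?_, Q, y, hQ, by omega, hy, hQZ y hy.1⟩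
      by_contra hxS
      have := h1 x hxS
      omega
    · obtain ⟨y, hy⟩ := exists_isKingOn hD hQne hQs
      exact absurd (hQk y hy) (hnoking y)
  have hK : ({x | ∃ X, D.IsHomog X ∧ (D.inBdry X).ncard = (D.inBdry X₀).ncard ∧
      D.IsTopOn X x} : Set V).Nonempty := by
    obtain ⟨x, hx⟩ := D.exists_isTopOn hX₀.nonempty
    exact ⟨x, X₀, hX₀, rfl, hx⟩
  obtain ⟨x, ⟨X, hX, hXmin, hx⟩, hxk⟩ := exists_isKingOn hD hK (by
    rintro a ⟨X, hX, hXmin, ha⟩ b ⟨Y, hY, hYmin, hb⟩ hab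
    exact hSc a (hstep X hX hXmin a ha).1 b (hstep Y hY hYmin b hb).1 hab)
  obtain ⟨-, Q, y, hQ, hQmin, hy, hyx, hxy⟩ := hstep X hX hXmin x hx
  exact hxy ((hxk y ⟨Q, hQ, hQmin, hy⟩ hyx).imp_right fun ⟨z, _, hz⟩ => ⟨z, hz⟩)

/-- In a strong local tournament a vertex `x` with an in-neighbour is never the only Sullivan-1
vertex. The previous lemma is applied to an initial strong component `U` of the digraph without
`x`, with `S = U ∩ N⁺(x)`. The critical case is a king `v` of `U` dominated by `x` that fails to
be a Sullivan-1 vertex of `D` by one; then a king of the tournament `U ∩ N⁻(x)` is one. -/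
theorem exists_isSullivan1_ne {V : Type*} [Finite V] {D : Digraph V} (hD : D.IsLocalTournament)
    (hS : D.StrongOn Set.univ) {x a : V} (hax : D.Adj a x) : ∃ y, y ≠ x ∧ D.IsSullivan1 y := by
  obtain ⟨U, hUx, hUne, hUcl, hUst⟩ := D.exists_initial_strong (T := {x}ᶜ) ⟨a, hD.ne hax⟩
  have hUx : x ∉ U := fun h => hUx h rfl
  have hUcl : ∀ q ∈ U, ∀ t, D.Adj t q → t ≠ x → t ∈ U := fun q hq t htq ht => hUcl q hq t ht htq
  have hUne' : Nonempty U := hUne.to_subtype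
  -- deleting `x` lowers the in-degree by at most one
  have hdeg : ∀ v : U, D.inDeg v ≤ (D.inducedOn U).inDeg v + 1 := by
    intro v
    rw [inDeg_inducedOn, inDeg]
    refine (Set.ncard_le_ncard (t := insert x (D.inNbhd v ∩ U)) fun t ht => ?_).trans
      (Set.ncard_insert_le _ _)
    by_cases htx : t = x
    · exact .inl htx
    · exact .inr ⟨ht, hUcl v v.2 t ht htx⟩
  rcases exists_inDeg_le_secondOutDeg (hD.inducedOn U) hUst.inducedOn (S := {v | D.Adj x v})
    (fun u hu v hv huv => hD.adj_of_out hu hv fun e => huv (Subtype.ext e)) with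
    ⟨v, hv, hle⟩ | ⟨v, hlt⟩ | ⟨v, hxv, hvk⟩
  · refine ⟨v, fun e => hUx (e ▸ v.2), ?_⟩
    refine le_trans (le_trans ?_ hle) (secondOutDeg_inducedOn_le D v)
    rw [inDeg_inducedOn, inDeg]
    exact Set.ncard_le_ncard fun t ht => ⟨ht, hUcl v v.2 t ht fun e => hv (e ▸ ht)⟩
  · refine ⟨v, fun e => hUx (e ▸ v.2), ?_⟩
    have h1 := hdeg v
    have h2 := secondOutDeg_inducedOn_le D v
    simp only [IsSullivan1]
    omega
  · by_cases hv1 : D.IsSullivan1 v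
    · exact ⟨v, fun e => hUx (e ▸ v.2), hv1⟩
    have hvx : ¬ D.Adj v x := hD.asymm hxv
    -- failing by one forces `N⁺⁺(v) = N⁻(v) \ {x}`
    have hsecond : D.secondOutNbhd v = D.inNbhd v ∩ U := by
      refine (Set.eq_of_subset_of_ncard_le (s := D.inNbhd v ∩ U) ?_ ?_).symm
      · rw [← image_inNbhd_inducedOn]
        exact (Set.image_mono (hvk.inNbhd_subset (hD.inducedOn U))).trans
          (image_secondOutNbhd_inducedOn_subset D v)
      · have h1 := hdeg v
        simp only [IsSullivan1] at hv1
        rw [← inDeg_inducedOn]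
        change D.secondOutDeg v ≤ _
        omega
    have hvA : ∀ a, D.Adj a x → ¬ D.Adj v a := by
      intro a ha hva
      have : x ∈ D.secondOutNbhd v := mem_secondOutNbhd.2 ⟨⟨a, hva, ha⟩, hvx⟩
      exact hUx (hsecond ▸ this).2
    have hUadj : ∀ u ∈ U, u ≠ v → ¬ D.Adj v u → D.Adj u v := by
      intro u hu huv hvu
      have hr := hvk ⟨u, hu⟩ fun e => huv (congrArg Subtype.val e)
      obtain ⟨w, hvw, hwu⟩ := hr.resolve_left hvu
      have : u ∈ D.secondOutNbhd v := mem_secondOutNbhd.2 ⟨⟨w, hvw, hwu⟩, hvu⟩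
      exact (hsecond ▸ this).1
    -- otherwise `U ∪ N⁺(v)` would be left by no arc, and `x` would not be reachable from `v`
    have hAU : ({a | a ∈ U ∧ D.Adj a x} : Set V).Nonempty := by
      by_contra hempty
      have hno : ∀ t ∈ U, ¬ D.Adj t x := fun t ht htx => hempty ⟨t, ht, htx⟩
      obtain ⟨t', ht', t, -, ht, htt'⟩ := hS {t | ¬ (t ∈ U ∨ D.Adj v t)} (Set.subset_univ _)
        ⟨x, fun h => h.elim hUx hvx⟩
        (fun h => (Set.ext_iff.1 h v).2 (Set.mem_univ _) (.inl v.2))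
      have ht := not_not.1 ht
      have hout : ∀ t, D.Adj v t → D.Adj t t' → False := by
        intro t hvt htt'
        by_cases hvt' : D.Adj v t'
        · exact ht' (.inr hvt')
        · have : t' ∈ D.secondOutNbhd v := mem_secondOutNbhd.2 ⟨⟨t, hvt, htt'⟩, hvt'⟩
          exact ht' (.inl (hsecond ▸ this).2)
      by_cases hvt : D.Adj v t
      · exact hout t hvt htt'
      · have htU := ht.resolve_right hvt
        by_cases htv : t = v
        · exact ht' (.inr (htv ▸ htt'))
        · have htv' := hUadj t htU htv hvt
          have hvt' : (v : V) ≠ t' := by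
            rintro e
            exact ht' (.inl (e ▸ v.2))
          rcases hD.adj_of_out htv' htt' hvt' with h | h
          · exact ht' (.inr h)
          · refine ht' (.inl (hUcl v v.2 t' h ?_))
            rintro rfl
            exact hno t htU htt'
    obtain ⟨a, haA, hak⟩ := exists_isKingOn hD hAU
      (fun b hb c hc hbc => hD.adj_of_in hb.2 hc.2 hbc)
    refine ⟨a, fun e => hUx (e ▸ haA.1), isSullivan1_of_subset fun u hu => ?_⟩
    have hua : D.Adj u a := hu
    refine mem_secondOutNbhd.2 ⟨?_, hD.asymm hua⟩
    have hux : u ≠ x := by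
      rintro rfl
      exact hD.asymm hua haA.2
    have huU : u ∈ U := hUcl a haA.1 u hua hux
    have huv : u ≠ v := by
      rintro rfl
      exact hvA a haA.2 hua
    have hav : D.Adj a v := by
      refine hUadj a haA.1 ?_ (hvA a haA.2)
      rintro rfl
      exact hvx haA.2
    by_cases hvu : D.Adj v u
    · exact ⟨v, hav, hvu⟩
    · rcases hD.adj_of_in (hUadj u huU huv hvu) hxv hux with h | h
      · obtain ⟨w, -, haw, hwu⟩ :=
          (hak u ⟨huU, h⟩ (hD.ne hua)).resolve_left (hD.asymm hua)
        exact ⟨w, haw, hwu⟩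
      · exact ⟨x, haA.2, h⟩

end Sullivan1
/-! ### Counting arcs inside a set -/

section Counting

variable {V : Type*} {D : Digraph V}

open Classical in
theorem sum_ncard_outNbhd_inter (D : Digraph V) (s : Finset V) :
    ∑ v ∈ s, (D.outNbhd v ∩ s).ncard = ∑ v ∈ s, (D.inNbhd v ∩ s).ncard := by
  have hout : ∀ v, (D.outNbhd v ∩ s).ncard = (s.bipartiteAbove D.Adj v).card := by
    intro v
    rw [← Set.ncard_coe_finset, Finset.coe_bipartiteAbove]
    congr 1
    ext u
    exact and_comm
  have hin : ∀ v, (D.inNbhd v ∩ s).ncard = (s.bipartiteBelow D.Adj v).card := by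
    intro v
    rw [← Set.ncard_coe_finset, Finset.coe_bipartiteBelow]
    congr 1
    ext u
    exact and_comm
  simp only [hout, hin]
  exact Finset.sum_card_bipartiteAbove_eq_sum_card_bipartiteBelow D.Adj

theorem disjoint_inNbhd_outNbhd (hD : D.IsLocalTournament) (v : V) :
    Disjoint (D.inNbhd v) (D.outNbhd v) :=
  Set.disjoint_left.2 fun _ hi ho => hD.asymm hi ho

variable [Finite V]

theorem ncard_inNbhd_add_ncard_outNbhd_lt (hD : D.IsLocalTournament) {X : Set V} {v : V}
    (hv : v ∈ X) : (D.inNbhd v ∩ X).ncard + (D.outNbhd v ∩ X).ncard < X.ncard := by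
  rw [← Set.ncard_union_eq ((disjoint_inNbhd_outNbhd hD v).mono Set.inter_subset_left
    Set.inter_subset_left)]
  refine Set.ncard_lt_ncard ⟨by grind, fun h => ?_⟩
  rcases h hv with h | h
  · exact hD.noLoops v h.1
  · exact hD.noLoops v h.1

theorem ncard_inNbhd_add_ncard_outNbhd_add_one (hD : D.IsLocalTournament) {X : Set V}
    {v : V} (hv : v ∈ X) (hX : ∀ u ∈ X, u ≠ v → D.Adj u v ∨ D.Adj v u) :
    (D.inNbhd v ∩ X).ncard + (D.outNbhd v ∩ X).ncard + 1 = X.ncard := by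
  refine le_antisymm (ncard_inNbhd_add_ncard_outNbhd_lt hD hv) ?_
  rw [← Set.ncard_union_eq ((disjoint_inNbhd_outNbhd hD v).mono Set.inter_subset_left
    Set.inter_subset_left)]
  refine (Set.ncard_le_ncard fun u hu => ?_).trans (Set.ncard_insert_le v _)
  by_cases huv : u = v
  · exact .inl huv
  · exact .inr ((hX u hu huv).imp (fun h => ⟨h, hu⟩) (fun h => ⟨h, hu⟩))

theorem SemicompleteOn.ncard_add_one (hD : D.IsLocalTournament) {X : Set V}
    (hX : D.SemicompleteOn X) {v : V} (hv : v ∈ X) :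
    (D.inNbhd v ∩ X).ncard + (D.outNbhd v ∩ X).ncard + 1 = X.ncard :=
  ncard_inNbhd_add_ncard_outNbhd_add_one hD hv fun u hu huv => hX u hu v hv huv

theorem IsTopOn.ncard_inNbhd_le (hD : D.IsLocalTournament) {X : Set V} (hX : D.SemicompleteOn X)
    {x : V} (hx : D.IsTopOn X x) : (D.inNbhd x ∩ X).ncard ≤ (D.outNbhd x ∩ X).ncard := by
  by_contra! hlt
  lift X to Finset V using X.toFinite
  refine absurd (D.sum_ncard_outNbhd_inter X) (Finset.sum_lt_sum_of_nonempty ⟨x, hx.1⟩ ?_).ne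
  intro v hv
  have h1 := hX.ncard_add_one hD hv
  have h2 := hX.ncard_add_one hD hx.1
  have h3 := hx.2 v hv
  omega

/-- If the out-degree of the only vertex of maximum out-degree in a homogeneous tournament exceeds
its in-degree by at most one, then the tournament is a single vertex: counting arcs leaves at most
two vertices, and a tournament on two vertices is not strong. -/
theorem IsHomog.eq_singleton (hD : D.IsLocalTournament) {X : Set V} (hX : D.IsHomog X) {x : V}
    (hx : D.IsTopOn X x) (huniq : ∀ y, D.IsTopOn X y → y = x)
    (hle : (D.outNbhd x ∩ X).ncard ≤ (D.inNbhd x ∩ X).ncard + 1) : X = {x} := by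
  classical
  have hcard : X.ncard ≤ 2 := by
    have hsemi := hX.semicomplete
    clear hX
    lift X to Finset V using X.toFinite
    have hsum := D.sum_ncard_outNbhd_inter X
    have hxX : x ∈ X := hx.1
    rw [← Finset.add_sum_erase _ _ hxX, ← Finset.add_sum_erase X (fun v => (D.inNbhd v ∩ X).ncard)
      hxX] at hsum
    have hlt : ∑ v ∈ X.erase x, ((D.outNbhd v ∩ X).ncard + 1) ≤
        ∑ v ∈ X.erase x, (D.inNbhd v ∩ X).ncard := by
      refine Finset.sum_le_sum fun v hv => ?_
      obtain ⟨hvx, hv⟩ := Finset.mem_erase.1 hv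
      have h1 := hsemi.ncard_add_one hD (v := v) hv
      have h2 := hsemi.ncard_add_one hD hx.1
      have h3 : (D.outNbhd v ∩ X).ncard < (D.outNbhd x ∩ X).ncard := by
        by_contra! h
        exact hvx (huniq v ⟨hv, fun y hy => (hx.2 y hy).trans h⟩)
      omega
    rw [Finset.sum_add_distrib, Finset.sum_const, Finset.card_erase_of_mem hxX] at hlt
    rw [Set.ncard_coe_finset]
    simp only [smul_eq_mul, mul_one] at hlt
    omega
  by_contra hne
  obtain ⟨y, hy, hyx⟩ : ∃ y ∈ X, y ≠ x := by
    by_contra! h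
    exact hne (Set.eq_singleton_iff_unique_mem.2 ⟨hx.1, h⟩)
  have hXeq : {x, y} = X := Set.eq_of_subset_of_ncard_le
    (by rintro z (rfl | rfl) <;> [exact hx.1; exact hy]) (by rwa [Set.ncard_pair hyx.symm])
  have harc : ∀ a ∈ X, ∀ b ∈ X, a ≠ b → (∀ z ∈ X, z ≠ a → z = b) → D.Adj b a := by
    intro a ha b hb hab hz
    obtain ⟨s, rfl, t, ht, hta, hts⟩ := hX.strong {a} (by simpa) ⟨a, rfl⟩
      (fun h => hab (h.symm ▸ hb : b ∈ ({a} : Set V)).symm)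
    exact hz t ht hta ▸ hts
  refine hD.asymm (harc x hx.1 y hy hyx.symm fun z hz hzx => ?_)
    (harc y hy x hx.1 hyx fun z hz hzy => ?_)
  · rw [← hXeq] at hz
    exact hz.resolve_left hzx
  · rw [← hXeq] at hz
    exact hz.resolve_right hzy

theorem exists_inDeg_le_outDeg [Nonempty V] (D : Digraph V) : ∃ v, D.inDeg v ≤ D.outDeg v := by
  have := Fintype.ofFinite V
  by_contra! h
  have hsum := D.sum_ncard_outNbhd_inter Finset.univ
  simp only [Finset.coe_univ, Set.inter_univ] at hsum
  exact absurd hsum (Finset.sum_lt_sum_of_nonempty Finset.univ_nonempty fun v _ => h v).ne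

end Counting

/-! ### Sullivan-2 vertices -/

section Sullivan2

variable {V : Type*} [Finite V] {D : Digraph V}

/-- Starting from a homogeneous set with more in- than out-neighbours, pass repeatedly to one that
is not adjacent to the previous one and is entered only from its out-neighbours. The number of
in-neighbours decreases until it is at most the number of out-neighbours. -/
theorem IsHomog.exists_balanced (hD : D.IsLocalTournament) (hS : D.StrongOn Set.univ) {X : Set V}
    (hX : D.IsHomog X) (hlt : (D.outBdry X).ncard < (D.inBdry X).ncard)
    (hna : ∃ x ∈ X, ∃ o ∉ X, ¬ D.Adj x o ∧ ¬ D.Adj o x) :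
    ∃ Q, D.IsHomog Q ∧ (D.inBdry Q).ncard ≤ (D.outBdry Q).ncard ∧
      (D.inBdry Q).ncard < (D.inBdry X).ncard := by
  induction hn : (D.inBdry X).ncard using Nat.strong_induction_on generalizing X with
  | _ n ih =>
    subst hn
    obtain ⟨x, hx, o, ho, hxo, hox⟩ := hna
    obtain ⟨Q, hQ, hQna, hQb⟩ := hX.exists_nonadj hD hS hx ho hxo hox
    have hle := Set.ncard_le_ncard hQb
    by_cases hbal : (D.inBdry Q).ncard ≤ (D.outBdry Q).ncard
    · exact ⟨Q, hQ, hbal, by omega⟩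
    obtain ⟨q, hq⟩ := hQ.nonempty
    obtain ⟨R, hR, hRb, hRlt⟩ := ih _ (by omega) hQ (by omega)
      ⟨q, hq, x, fun h => (hQna x h).1 hx, (hQna q hq).2.2, (hQna q hq).2.1⟩ rfl
    exact ⟨R, hR, hRb, by omega⟩

/-- The homogeneous set `Q` given by the trichotomy for `x ∈ X` either is adjacent to every vertex
outside, and then dominates `x` and the out-neighbours of `X`, or the descent of the preceding
lemma applies to it. -/
theorem IsHomog.balanced_or_exists_nonadj (hD : D.IsLocalTournament) {X : Set V}
    (hX : D.IsHomog X) {x : V} (hx : x ∈ X) {Q : Set V}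
    (hQ : D.IsHomog Q) (hQZ : ∀ q ∈ Q, q ≠ x ∧ ¬ D.Reach x q)
    (hQx : (∀ q ∈ Q, ¬ D.Adj q x) ∨ ∀ q ∈ Q, D.Adj q x)
    (hle : (D.inBdry Q).ncard ≤ (D.outBdry X).ncard + 1) :
    (D.inBdry Q).ncard ≤ (D.outBdry Q).ncard ∨
      ∃ q ∈ Q, ∃ o ∉ Q, ¬ D.Adj q o ∧ ¬ D.Adj o q := by
  by_contra! hcon
  obtain ⟨hlt, hadj⟩ := hcon
  obtain ⟨q, hq⟩ := hQ.nonempty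
  have hxQ : x ∉ Q := fun h => (hQZ x h).1 rfl
  have hqx : D.Adj q x := by
    refine (hQx.resolve_left fun h => ?_) q hq
    exact (hQZ q hq).2 (.inl (hadj q hq x hxQ (h q hq)))
  have hsub : insert x (D.outBdry X) ⊆ D.outBdry Q := by
    rintro b (rfl | hb)
    · exact ⟨hxQ, q, hq, hqx⟩
    · have hxb := ((hX.mem_outBdry_iff hD hx).1 hb).2
      have hbQ : b ∉ Q := fun h => (hQZ b h).2 (.inl hxb)
      refine ⟨hbQ, q, hq, ?_⟩
      by_contra hqb
      exact (hQZ q hq).2 (.inr ⟨b, hxb, hadj q hq b hbQ hqb⟩)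
  have hcard := Set.ncard_le_ncard hsub
  rw [Set.ncard_insert_of_notMem fun h => ((hX.mem_outBdry_iff hD hx).1 h).1 hx] at hcard
  omega

/-- In the third case of the trichotomy, a vertex `y` of maximum out-degree in `Q` satisfies
the Sullivan-2 inequality with slack two, provided that `N⁺⁺(x) \ X` is small enough. The vertices
outside `N⁻(y)` include `X`, the out-neighbours of `X`, and the out-neighbours of `y` in `Q`. -/
theorem IsHomog.slack_of_king (hD : D.IsLocalTournament) {X : Set V} (hX : D.IsHomog X) {x : V}
    (hx : x ∈ X) {Q : Set V} (hQ : D.SemicompleteOn Q)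
    (hQx : ∀ q ∈ Q, q ∉ X ∧ D.Adj q x ∧ ¬ D.Reach x q)
    (hin : ∀ q ∈ Q, ∀ u, D.Adj u q → u ∈ Q ∨ u ∈ D.secondOutNbhd x \ X) {y : V}
    (hy : D.IsTopOn Q y) (hk : D.IsKing y)
    (hle : (D.secondOutNbhd x \ X).ncard + 2 ≤ (D.outBdry X).ncard + X.ncard) :
    2 * D.inDeg y + 2 ≤ D.secondOutDeg y + D.outDeg y := by
  have htop := hy.ncard_inNbhd_le hD hQ
  have h1 : D.inDeg y ≤ (D.inNbhd y ∩ Q).ncard + (D.secondOutNbhd x \ X).ncard :=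
    (Set.ncard_le_ncard fun u hu => (hin y hy.1 u hu).imp (fun h => ⟨hu, h⟩) id).trans
      (Set.ncard_union_le _ _)
  have hd1 : Disjoint X (D.outBdry X) := Set.disjoint_left.2 fun u hu h => h.1 hu
  have hd2 : Disjoint (X ∪ D.outBdry X) (D.outNbhd y ∩ Q) := by
    refine Set.disjoint_left.2 ?_
    rintro u (hu | hu) ⟨-, huQ⟩
    · exact (hQx u huQ).1 hu
    · exact (hQx u huQ).2.2 (.inl ((hX.mem_outBdry_iff hD hx).1 hu).2)
  have hd3 : Disjoint (X ∪ D.outBdry X ∪ D.outNbhd y ∩ Q) (D.inNbhd y) := by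
    refine Set.disjoint_left.2 ?_
    rintro u ((hu | hu) | ⟨hu, -⟩) hy'
    · exact hD.asymm hy' (hX.adj_in y (hQx y hy.1).1 x hx (hQx y hy.1).2.1 u hu)
    · exact (hQx y hy.1).2.2 (.inr ⟨u, ((hX.mem_outBdry_iff hD hx).1 hu).2, hy'⟩)
    · exact hD.asymm hu hy'
  have hsub : X ∪ D.outBdry X ∪ D.outNbhd y ∩ Q ∪ D.inNbhd y ⊆
      D.secondOutNbhd y ∪ D.outNbhd y := by
    intro u hu
    have huy : u ≠ y := by
      rintro rfl
      rcases hu with ((hu | hu) | ⟨hu, -⟩) | hu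
      · exact (hQx u hy.1).1 hu
      · exact (hQx u hy.1).2.2 (.inl ((hX.mem_outBdry_iff hD hx).1 hu).2)
      · exact hD.noLoops u hu
      · exact hD.noLoops u hu
    by_cases hyu : D.Adj y u
    · exact .inr hyu
    · exact .inl (mem_secondOutNbhd.2 ⟨(hk u huy).resolve_left hyu, hyu⟩)
  have hcard := (Set.ncard_le_ncard hsub).trans (Set.ncard_union_le _ _)
  rw [Set.ncard_union_eq hd3, Set.ncard_union_eq hd2, Set.ncard_union_eq hd1] at hcard
  simp only [inDeg, outDeg, secondOutDeg] at *
  omega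

/-- Among the homogeneous sets with at least as many out- as in-neighbours let `X` have the fewest
in-neighbours, and let `x` have maximum out-degree in `X`. Then `N⁺⁺(x) \ X` is at least as large
as the set of in-neighbours of `X`, unless there is a vertex with slack two. -/
theorem IsHomog.ncard_inBdry_le (hD : D.IsLocalTournament) (hS : D.StrongOn Set.univ) {X : Set V}
    (hX : D.IsHomog X) (hbal : (D.inBdry X).ncard ≤ (D.outBdry X).ncard)
    (hmin : ∀ Q, D.IsHomog Q → (D.inBdry Q).ncard ≤ (D.outBdry Q).ncard →
      (D.inBdry X).ncard ≤ (D.inBdry Q).ncard) {x : V} (hx : D.IsTopOn X x)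
    (hslack : ∀ y, D.secondOutDeg y + D.outDeg y < 2 * D.inDeg y + 2) :
    (D.inBdry X).ncard ≤ (D.secondOutNbhd x \ X).ncard := by
  have hxk := hx.isKingOn hD hX.semicomplete
  rcases hX.trichotomy hD hS hxk with h | ⟨Q, hQ, hQZ, hQb, hQx⟩ | ⟨Q, hQne, hQs, hQx, hin, hQk⟩
  · exact Set.ncard_le_ncard (hX.inBdry_subset hD hx.1 h)
  · by_contra! hlt
    have hle := Set.ncard_le_ncard hQb
    have hQmin := hmin Q hQ
    have hna := (hX.balanced_or_exists_nonadj hD hx.1 hQ hQZ hQx (by omega)).resolve_left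
      (fun h => by have := hQmin h; omega)
    obtain ⟨R, hR, hRbal, hRlt⟩ := hQ.exists_balanced hD hS
      (by by_contra! h; have := hQmin h; omega) hna
    have := hmin R hR hRbal
    omega
  · by_contra! hlt
    obtain ⟨y, hy⟩ := D.exists_isTopOn hQne
    have hXpos := (Set.ncard_pos).2 hX.nonempty
    refine absurd (hslack y) (not_lt.2 (hX.slack_of_king hD hx.1 hQs hQx hin hy
      (hQk y (hy.isKingOn hD hQs)) (by omega)))

/-- In a local tournament, `d⁻(x) ≤ d⁺(x) ≤ d⁻(x) + 1`, `x` adjacent to all other vertices,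
and all other in-degrees larger than `d⁻(x) ≥ 1` is impossible, since the in-degrees add up to at
most `n (n - 1) / 2`. -/
theorem exists_inDeg_le_of_adj_all (hD : D.IsLocalTournament) {x : V}
    (hadj : ∀ u, u ≠ x → D.Adj u x ∨ D.Adj x u) (h0 : D.inDeg x ≠ 0)
    (h1 : D.inDeg x ≤ D.outDeg x) (h2 : D.outDeg x ≤ D.inDeg x + 1) :
    ∃ v, v ≠ x ∧ D.inDeg v ≤ D.inDeg x := by
  classical
  have := Fintype.ofFinite V
  by_contra! hcon
  have hn := ncard_inNbhd_add_ncard_outNbhd_add_one hD (Set.mem_univ x) fun u _ => hadj u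
  have hle : ∀ v, D.inDeg v + D.outDeg v + 1 ≤ Fintype.card V := by
    intro v
    have := ncard_inNbhd_add_ncard_outNbhd_lt hD (Set.mem_univ v)
    simpa [inDeg, outDeg, Set.ncard_univ, Nat.card_eq_fintype_card] using this
  have hn : D.inDeg x + D.outDeg x + 1 = Fintype.card V := by
    simpa [inDeg, outDeg, Set.ncard_univ, Nat.card_eq_fintype_card] using hn
  have hsum : ∑ v, D.outDeg v = ∑ v, D.inDeg v := by
    simpa [inDeg, outDeg] using D.sum_ncard_outNbhd_inter Finset.univ
  have hsum1 : Fintype.card V * (D.inDeg x + 1) ≤ ∑ v, D.inDeg v + 1 := by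
    have : ∑ v ∈ Finset.univ.erase x, (D.inDeg x + 1) ≤ ∑ v ∈ Finset.univ.erase x, D.inDeg v :=
      Finset.sum_le_sum fun v hv => hcon v (Finset.mem_erase.1 hv).1
    rw [← Finset.add_sum_erase _ _ (Finset.mem_univ x)]
    have hc : ∑ v : V, (D.inDeg x + 1) = Fintype.card V * (D.inDeg x + 1) := by simp
    rw [← hc, ← Finset.add_sum_erase _ _ (Finset.mem_univ x)]
    omega
  have hsum2 : ∑ v, D.inDeg v + ∑ v, D.outDeg v + Fintype.card V ≤
      Fintype.card V * Fintype.card V := by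
    have := Finset.sum_le_sum fun v (_ : v ∈ Finset.univ) => hle v
    simpa [Finset.sum_add_distrib] using this
  have h3 : Fintype.card V ≤ 2 * D.inDeg x + 2 := by omega
  have h4 := Nat.mul_le_mul_left (Fintype.card V) h3
  have h5 : Fintype.card V * (2 * D.inDeg x + 2) = 2 * (Fintype.card V * (D.inDeg x + 1)) := by
    ring
  omega

/-- Part (c) for strong digraphs. If it fails, the homogeneous set `X` with fewest in-neighbours
among those with at least as many out- as in-neighbours is unique and a single vertex `x`. If some
vertex is not adjacent to `x`, the trichotomy for `x` leads to another such set or to a vertex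
with slack two; otherwise the in-degrees are too large. -/
theorem exists_isSullivan2_pair_or_slack [Nonempty V] (hD : D.IsLocalTournament)
    (hS : D.StrongOn Set.univ) (hdeg : ∀ x, D.inDeg x ≠ 0) :
    (∃ x y, x ≠ y ∧ D.IsSullivan2 x ∧ D.IsSullivan2 y) ∨
      ∃ v, 2 * D.inDeg v + 2 ≤ D.secondOutDeg v + D.outDeg v := by
  by_contra! hcon
  obtain ⟨hpair, hslack⟩ := hcon
  obtain ⟨v₀, hv₀⟩ := D.exists_inDeg_le_outDeg
  obtain ⟨X₀, ⟨hX₀, hbal₀⟩, hmin₀⟩ := Set.exists_min_image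
    {X | D.IsHomog X ∧ (D.inBdry X).ncard ≤ (D.outBdry X).ncard}
    (fun X => (D.inBdry X).ncard) (Set.toFinite _)
    ⟨{v₀}, D.isHomog_singleton v₀, by
      rw [inBdry_singleton hD, outBdry_singleton hD]
      exact hv₀⟩
  -- every set attaining the minimum is a single Sullivan-2 vertex
  have hmins : ∀ X, D.IsHomog X → (D.inBdry X).ncard ≤ (D.outBdry X).ncard →
      (D.inBdry X).ncard ≤ (D.inBdry X₀).ncard →
      ∃ x, X = {x} ∧ D.IsSullivan2 x ∧ (D.inBdry X).ncard ≤ (D.secondOutNbhd x \ X).ncard := by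
    intro X hX hbal hle
    have hc : ∀ x, D.IsTopOn X x →
        (D.inBdry X).ncard ≤ (D.secondOutNbhd x \ X).ncard ∧ D.IsSullivan2 x ∧
          (D.outNbhd x ∩ X).ncard ≤ (D.inNbhd x ∩ X).ncard + 1 := by
      intro x hx
      have h1 := hX.ncard_inBdry_le hD hS hbal
        (fun Q hQ hQb => hle.trans (hmin₀ Q ⟨hQ, hQb⟩)) hx hslack
      have h2 := hX.inDeg_eq hx.1
      have h3 := hX.outDeg_eq hD hx.1
      have h4 := hX.secondOutDeg_eq hD (hx.isKingOn hD hX.semicomplete)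
      have h5 := hx.ncard_inNbhd_le hD hX.semicomplete
      have h6 := hslack x
      refine ⟨h1, ?_, by omega⟩
      simp only [IsSullivan2]
      omega
    obtain ⟨x, hx⟩ := D.exists_isTopOn hX.nonempty
    obtain ⟨h1, h2, h3⟩ := hc x hx
    refine ⟨x, hX.eq_singleton hD hx (fun y hy => ?_) h3, h2, h1⟩
    by_contra hyx
    exact hpair y x hyx (hc y hy).2.1 h2
  obtain ⟨x, rfl, hx2, hxC⟩ := hmins X₀ hX₀ hbal₀ le_rfl
  have huniq : ∀ Q, D.IsHomog Q → (D.inBdry Q).ncard ≤ (D.inBdry {x}).ncard →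
      ((D.inBdry Q).ncard ≤ (D.outBdry Q).ncard ∨
        ∃ q ∈ Q, ∃ o ∉ Q, ¬ D.Adj q o ∧ ¬ D.Adj o q) → Q = {x} := by
    intro Q hQ hle h
    by_cases hbal : (D.inBdry Q).ncard ≤ (D.outBdry Q).ncard
    · obtain ⟨y, rfl, hy2, -⟩ := hmins Q hQ hbal hle
      by_contra hne
      exact hpair y x (fun e => hne (e ▸ rfl)) hy2 hx2
    · obtain ⟨R, hR, hRbal, hRlt⟩ := hQ.exists_balanced hD hS (by omega) (h.resolve_left hbal)
      have := hmin₀ R ⟨hR, hRbal⟩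
      omega
  have hxtop : D.IsTopOn {x} x := ⟨rfl, by rintro y rfl; exact le_rfl⟩
  have hxk := hxtop.isKingOn hD hX₀.semicomplete
  have hin := hX₀.inDeg_eq rfl
  have hout := hX₀.outDeg_eq hD rfl
  have hsec := hX₀.secondOutDeg_eq hD hxk
  have htop := hxtop.ncard_inNbhd_le hD hX₀.semicomplete
  have hsx := hslack x
  by_cases hO : ∃ o, o ≠ x ∧ ¬ D.Adj x o ∧ ¬ D.Adj o x
  · obtain ⟨o, hox, hxo, hox'⟩ := hO
    obtain ⟨Q, hQ, hQna, hQb⟩ := hX₀.exists_nonadj hD hS rfl hox hxo hox'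
    obtain ⟨q, hq⟩ := hQ.nonempty
    have hlt : (D.inBdry {x}).ncard < (D.outBdry {x}).ncard := by
      refine lt_of_lt_of_le ?_ (Set.ncard_le_ncard hQb)
      by_contra! hle
      refine (hQna q hq).1 (huniq Q hQ hle (.inr ?_) ▸ hq)
      exact ⟨q, hq, x, fun h => (hQna x h).1 rfl, (hQna q hq).2.2, (hQna q hq).2.1⟩
    rcases hX₀.trichotomy hD hS hxk with h | ⟨R, hR, hRZ, hRb, hRx⟩ | ⟨R, hRne, hRs, hRx, hRin, hRk⟩
    · have hsub : insert o (D.inBdry {x}) ⊆ D.secondOutNbhd x \ {x} := by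
        rintro u (rfl | hu)
        · exact ⟨mem_secondOutNbhd.2 ⟨(h u hox).resolve_left hxo, hxo⟩, hox⟩
        · exact hX₀.inBdry_subset hD rfl h hu
      have hcard := Set.ncard_le_ncard hsub
      rw [Set.ncard_insert_of_notMem
        fun h => hox' ((hX₀.mem_inBdry_iff rfl).1 h).2] at hcard
      omega
    · have hle := Set.ncard_le_ncard hRb
      have hRx' := huniq R hR (by omega)
        (hX₀.balanced_or_exists_nonadj hD rfl hR hRZ hRx (by omega))
      exact (hRZ x (hRx' ▸ rfl)).1 rfl
    · obtain ⟨y, hy⟩ := D.exists_isTopOn hRne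
      refine absurd (hslack y) (not_lt.2 (hX₀.slack_of_king hD rfl hRs hRx hRin hy
        (hRk y (hy.isKingOn hD hRs)) ?_))
      rw [Set.ncard_singleton]
      omega
  · have hadj : ∀ u, u ≠ x → D.Adj u x ∨ D.Adj x u := by
      intro u hu
      by_contra! h
      exact hO ⟨u, hu, h.2, h.1⟩
    have hinx : (D.inBdry {x}).ncard = D.inDeg x := by
      rw [inBdry_singleton hD, inDeg]
    have houtx : (D.outBdry {x}).ncard = D.outDeg x := by
      rw [outBdry_singleton hD, outDeg]
    obtain ⟨v, hvx, hv⟩ := exists_inDeg_le_of_adj_all hD hadj (hdeg x) (by omega) (by omega)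
    refine hvx (Set.singleton_injective (huniq {v} (D.isHomog_singleton v) ?_ ?_))
    · rw [hinx, inBdry_singleton hD]
      exact hv
    · by_contra! hcon
      obtain ⟨hlt, hva⟩ := hcon
      rw [inBdry_singleton hD, outBdry_singleton hD] at hlt
      have h1 := ncard_inNbhd_add_ncard_outNbhd_add_one hD (Set.mem_univ v) fun u _ hu =>
        or_iff_not_imp_right.2 (hva v rfl u hu)
      have h2 := ncard_inNbhd_add_ncard_outNbhd_add_one hD (Set.mem_univ x) fun u _ => hadj u
      simp only [Set.inter_univ] at h1 h2
      simp only [inDeg, outDeg] at *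
      omega

end Sullivan2

end Digraph

/-! ### Reduction to strong digraphs -/

theorem mainTheorem1 {V : Type*} [Finite V] [Nonempty V] (D : Digraph V)
    (hD : D.IsLocalTournament) :
    ((∃ x, D.IsSullivan1 x) ∧ (∃ x, D.IsSullivan2 x)) ∧
    ((∀ x, D.inDeg x ≠ 0) → ∃ x y, x ≠ y ∧ D.IsSullivan1 x ∧ D.IsSullivan1 y) ∧
    ((∀ x, D.inDeg x ≠ 0) →
      (∃ x y, x ≠ y ∧ D.IsSullivan2 x ∧ D.IsSullivan2 y) ∨
      (∃ v, D.IsSullivan2 v ∧ 2 * D.inDeg v + 2 ≤ D.secondOutDeg v + D.outDeg v)) := by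
  -- an initial strong component keeps in-degrees and does not gain out- or second out-neighbours
  obtain ⟨U, -, hUne, hUcl, hUst⟩ := D.exists_initial_strong (T := Set.univ) Set.univ_nonempty
  have hUne' : Nonempty U := hUne.to_subtype
  have hin : ∀ v : U, (D.inducedOn U).inDeg v = D.inDeg v :=
    Digraph.inDeg_inducedOn_eq fun q hq t htq => hUcl q hq t trivial htq
  have hout : ∀ v : U, (D.inducedOn U).outDeg v ≤ D.outDeg v := Digraph.outDeg_inducedOn_le D
  have hsec : ∀ v : U, (D.inducedOn U).secondOutDeg v ≤ D.secondOutDeg v :=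
    Digraph.secondOutDeg_inducedOn_le D
  have h1 : ∀ v : U, (D.inducedOn U).IsSullivan1 v → D.IsSullivan1 v := fun v hv =>
    ((hin v).symm.trans_le hv).trans (hsec v)
  have h2 : ∀ v : U, (D.inducedOn U).IsSullivan2 v → D.IsSullivan2 v := by
    intro v hv
    have := hin v
    have := hout v
    have := hsec v
    simp only [Digraph.IsSullivan2] at hv ⊢
    omega
  have hb : (∀ x, D.inDeg x ≠ 0) → ∃ x y, x ≠ y ∧ D.IsSullivan1 x ∧ D.IsSullivan1 y := by
    intro hdeg
    have hne : ∀ x : U, ∃ y, y ≠ x ∧ (D.inducedOn U).IsSullivan1 y := by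
      intro x
      have hx : (D.inducedOn U).inDeg x ≠ 0 := hin x ▸ hdeg x
      obtain ⟨a, ha⟩ := Set.nonempty_of_ncard_ne_zero hx
      exact Digraph.exists_isSullivan1_ne (hD.inducedOn U) hUst.inducedOn ha
    obtain ⟨x, -, hx⟩ := hne (Classical.arbitrary U)
    obtain ⟨y, hyx, hy⟩ := hne x
    exact ⟨y, x, fun e => hyx (Subtype.ext e), h1 y hy, h1 x hx⟩
  have hc : (∀ x, D.inDeg x ≠ 0) → (∃ x y, x ≠ y ∧ D.IsSullivan2 x ∧ D.IsSullivan2 y) ∨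
      (∃ v, D.IsSullivan2 v ∧ 2 * D.inDeg v + 2 ≤ D.secondOutDeg v + D.outDeg v) := by
    intro hdeg
    rcases Digraph.exists_isSullivan2_pair_or_slack (hD.inducedOn U) hUst.inducedOn
      (fun v => hin v ▸ hdeg v) with ⟨x, y, hxy, hx, hy⟩ | ⟨v, hv⟩
    · exact .inl ⟨x, y, fun e => hxy (Subtype.ext e), h2 x hx, h2 y hy⟩
    · have := hin v
      have := hout v
      have := hsec v
      have hv' : 2 * D.inDeg v + 2 ≤ D.secondOutDeg v + D.outDeg v := by omega
      refine .inr ⟨v, ?_, hv'⟩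
      simp only [Digraph.IsSullivan2]
      omega
  refine ⟨?_, hb, hc⟩
  by_cases hdeg : ∀ x, D.inDeg x ≠ 0
  · obtain ⟨x, -, -, hx, -⟩ := hb hdeg
    refine ⟨⟨x, hx⟩, ?_⟩
    rcases hc hdeg with ⟨y, -, -, hy, -⟩ | ⟨y, hy, -⟩
    · exact ⟨y, hy⟩
    · exact ⟨y, hy⟩
  -- a vertex of in-degree zero satisfies both inequalities trivially
  · push Not at hdeg
    obtain ⟨x, hx⟩ := hdeg
    exact ⟨⟨x, by simp [Digraph.IsSullivan1, hx]⟩, ⟨x, by simp [Digraph.IsSullivan2, hx]⟩⟩
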